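/- Let $\mathbf{S}$ be the category of simplicial sets with its standard (Kan–Quillen) model structure, and let $\mathbf{S}\text{-}\mathbf{Cat}$ be the category of small simplicial categories (small categories enriched in $\mathbf{S}$) and simplicial functors. For a simplicial category $\mathcal{A}$ let $[\mathcal{A}]$ be the category with the same objects and with $[\mathcal{A}](x,y)=\pi_0\mathcal{A}(x,y)$. A simplicial functor $f:\mathcal{A}\to\mathcal{B}$ is a *trivial fibration* if every map $f_{x,y}:\mathcal{A}(x,y)\to\mathcal{B}(f(x),f(y))$ is both a Kan fibration and a weak equivalence and the functor $[f]:[\mathcal{A}]\to[\mathcal{B}]$ is both an isofibration and essentially surjective. (A functor $g:C\to D$ is an isofibration if for every object $x$ of $C$ and every isomorphism $v:y'\to g(x)$ of $D$ there is an isomorphism $u:x'\to x$ of $C$ with $g(u)=v$.) A simplicial functor is a *cofibration* if it has the left lifting property with respect to all trivial fibrations, and $\mathcal{A}$ is *cofibrant* if $\emptyset\to\mathcal{A}$ is a cofibration. A map of simplicial monoids (monoids in $(\mathbf{S},\times)$) is a *trivial fibration* if its underlying map of simplicial sets is both a Kan fibration and a weak equivalence; it is a *cofibration* if it has the left lifting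 property with respect to all trivial fibrations of simplicial monoids; a simplicial monoid is *cofibrant* if the map to it from the initial simplicial monoid is a cofibration. **Lemma 2.4.** Let $\mathcal{A}$ be a cofibrant simplicial category. Then for each object $a$ of $\mathcal{A}$ the endomorphism simplicial monoid $\mathcal{A}(a,a)$, with multiplication the composition of $\mathcal{A}$ and unit $\mathrm{id}_a$, is cofibrant. -/

import Mathlib

open CategoryTheory MonoidalCategory HomotopicalAlgebra Opposite Simplicial
open scoped SSet.modelCategoryQuillen

universe u

/-! ### Simplicial sets

Mathlib provides the cofibrations (monomorphisms) and the fibrations (Kan fibrations) of the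
standard model structure on simplicial sets. We add its weak equivalences. -/

/-- The weak equivalences of the standard (Kan-Quillen) model structure on simplicial sets.
The acyclic cofibrations of this structure are the anodyne extensions (the maps with the left
lifting property against Kan fibrations), its acyclic fibrations are the maps with the right
lifting property against the boundary inclusions `∂Δ[n] ⟶ Δ[n]`, and a map is a weak equivalence
if and only if it is an acyclic cofibration followed by an acyclic fibration. -/
instance sSetWeakEquivalences : CategoryWithWeakEquivalences SSet.{u} where
  weakEquivalences := fun X Y f =>
    ∃ (Z : SSet.{u}) (i : X ⟶ Z) (p : Z ⟶ Y),
      SSet.anodyneExtensions i ∧ SSet.modelCategoryQuillen.I.rlp p ∧ i ≫ p = f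

/-! ### The category of small simplicial categories -/

/-- A small simplicial category: a (small) set of objects, with a category structure enriched in
simplicial sets. -/
structure SCat : Type (u + 1) where
  /-- The set of objects. -/
  Obj : Type u
  /-- The enrichment in simplicial sets. -/
  [enriched : EnrichedCategory SSet.{u} Obj]

namespace SCat

instance : CoeSort SCat.{u} (Type u) := ⟨SCat.Obj⟩

attribute [instance] SCat.enriched

/-- The simplicial set of morphisms from `x` to `y`. -/
abbrev hom (A : SCat.{u}) (x y : A) : SSet.{u} := EnrichedCategory.Hom x y

/-- Simplicial categories and simplicial functors form a category. -/
instance : Category SCat.{u} where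
  Hom A B := EnrichedFunctor SSet.{u} A B
  id A := EnrichedFunctor.id SSet.{u} A
  comp F G := EnrichedFunctor.comp SSet.{u} F G
  id_comp _ := EnrichedFunctor.ext _ (fun _ => rfl)
    (fun _ _ => (Category.comp_id _).trans (Category.id_comp _))
  comp_id _ := EnrichedFunctor.ext _ (fun _ => rfl)
    (fun _ _ => (Category.comp_id _).trans (Category.comp_id _))
  assoc _ _ _ := EnrichedFunctor.ext _ (fun _ => rfl)
    (fun _ _ => (Category.comp_id _).trans (Category.assoc _ _ _))

/-- The action of a simplicial functor on objects. -/
abbrev onObj {A B : SCat.{u}} (F : A ⟶ B) (x : A) : B := EnrichedFunctor.obj F x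

/-- The action `A(x, y) ⟶ B(F x, F y)` of a simplicial functor on morphisms. -/
abbrev onHom {A B : SCat.{u}} (F : A ⟶ B) (x y : A) :
    A.hom x y ⟶ B.hom (onObj F x) (onObj F y) := EnrichedFunctor.map F x y

/-- The empty simplicial category. -/
def empty : SCat.{u} where
  Obj := PEmpty.{u + 1}
  enriched :=
    { Hom := fun x => x.elim
      id := fun x => x.elim
      comp := fun x => x.elim
      id_comp := fun x => x.elim
      comp_id := fun x => x.elim
      assoc := fun x => x.elim }

instance (A : SCat.{u}) : Unique (empty.{u} ⟶ A) where
  default :=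
    { obj := fun x => PEmpty.elim x
      map := fun x => PEmpty.elim x
      map_id := fun x => PEmpty.elim x
      map_comp := fun x => PEmpty.elim x }
  uniq _ := EnrichedFunctor.ext _ (fun x => PEmpty.elim x) (fun x => PEmpty.elim x)

instance : Limits.HasInitial SCat.{u} := Limits.hasInitial_of_unique empty

/-! ### The category of components -/

/-- The objects of the category of components of a simplicial category. -/
structure Components (A : SCat.{u}) : Type u where
  /-- The underlying object of the simplicial category. -/
  as : A

/-- The identity of `x`, as a vertex of `A(x, x)`. -/
def idVertex (A : SCat.{u}) (x : A) : (A.hom x x) _⦋0⦌ :=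
  (eId SSet.{u} x).app (op ⦋0⦌) PUnit.unit

/-- A pair of `n`-simplices, as an `n`-simplex of the product. -/
abbrev simplexPair {X Y : SSet.{u}} {n : SimplexCategoryᵒᵖ} (f : X.obj n) (g : Y.obj n) :
    (X ⊗ Y).obj n := ⟨f, g⟩

/-- Composition of `n`-simplices, in diagrammatic order. -/
def compSimplex (A : SCat.{u}) {x y z : A} {n : SimplexCategoryᵒᵖ}
    (f : (A.hom x y).obj n) (g : (A.hom y z).obj n) : (A.hom x z).obj n :=
  (eComp SSet.{u} x y z).app n (simplexPair f g)

lemma map_compSimplex (A : SCat.{u}) {x y z : A} {m n : SimplexCategoryᵒᵖ} (α : m ⟶ n)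
    (f : (A.hom x y).obj m) (g : (A.hom y z).obj m) :
    (A.hom x z).map α (A.compSimplex f g) =
      A.compSimplex ((A.hom x y).map α f) ((A.hom y z).map α g) :=
  (NatTrans.naturality_apply (eComp SSet.{u} x y z) α
    (simplexPair (X := A.hom x y) (Y := A.hom y z) f g)).symm

lemma idVertex_comp (A : SCat.{u}) {x y : A} (f : (A.hom x y) _⦋0⦌) :
    A.compSimplex (A.idVertex x) f = f :=
  ConcreteCategory.congr_hom (congr_app (e_id_comp SSet.{u} x y) (op ⦋0⦌)) f

lemma comp_idVertex (A : SCat.{u}) {x y : A} (f : (A.hom x y) _⦋0⦌) :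
    A.compSimplex f (A.idVertex y) = f :=
  ConcreteCategory.congr_hom (congr_app (e_comp_id SSet.{u} x y) (op ⦋0⦌)) f

lemma compSimplex_assoc (A : SCat.{u}) {w x y z : A} {n : SimplexCategoryᵒᵖ}
    (f : (A.hom w x).obj n) (g : (A.hom x y).obj n) (h : (A.hom y z).obj n) :
    A.compSimplex (A.compSimplex f g) h = A.compSimplex f (A.compSimplex g h) :=
  ConcreteCategory.congr_hom (congr_app (e_assoc SSet.{u} w x y z) n)
    (simplexPair (X := A.hom w x) (Y := A.hom x y ⊗ A.hom y z) f
      (simplexPair (X := A.hom x y) (Y := A.hom y z) g h))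

/-- The composite of two edges in simplicial sets of morphisms. -/
def compEdge (A : SCat.{u}) {x y z : A} {f₀ f₁ : (A.hom x y) _⦋0⦌} {g₀ g₁ : (A.hom y z) _⦋0⦌}
    (e : (A.hom x y).Edge f₀ f₁) (e' : (A.hom y z).Edge g₀ g₁) :
    (A.hom x z).Edge (A.compSimplex f₀ g₀) (A.compSimplex f₁ g₁) :=
  SSet.Edge.mk (A.compSimplex e.edge e'.edge)
    ((A.map_compSimplex _ _ _).trans (congrArg₂ A.compSimplex e.src_eq e'.src_eq))
    ((A.map_compSimplex _ _ _).trans (congrArg₂ A.compSimplex e.tgt_eq e'.tgt_eq))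

/-- Composition of connected components of the simplicial sets of morphisms. -/
def compComponents (A : SCat.{u}) {x y z : A} (f : (A.hom x y).π₀) (g : (A.hom y z).π₀) :
    (A.hom x z).π₀ :=
  SSet.π₀.lift
    (fun f₀ => SSet.π₀.lift (fun g₀ => SSet.π₀.mk (A.compSimplex f₀ g₀))
      (fun _ _ e => SSet.π₀.sound (A.compEdge (SSet.Edge.id f₀) e)) g)
    (fun f₀ f₁ e => by
      obtain ⟨g₀, rfl⟩ := g.mk_surjective
      exact SSet.π₀.sound (A.compEdge e (SSet.Edge.id g₀))) f

/-- The category of components of a simplicial category `A`: it has the objects of `A`, and its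
morphisms from `x` to `y` are the connected components of `A(x, y)`, that is, the morphisms from
the point to `A(x, y)` in the homotopy category of simplicial sets. -/
instance (A : SCat.{u}) : Category.{u} A.Components where
  Hom x y := (A.hom x.as y.as).π₀
  id x := SSet.π₀.mk (A.idVertex x.as)
  comp f g := A.compComponents f g
  id_comp f := by
    obtain ⟨f, rfl⟩ := SSet.π₀.mk_surjective f
    exact congrArg SSet.π₀.mk (A.idVertex_comp f)
  comp_id f := by
    obtain ⟨f, rfl⟩ := SSet.π₀.mk_surjective f
    exact congrArg SSet.π₀.mk (A.comp_idVertex f)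
  assoc f g h := by
    obtain ⟨f, rfl⟩ := SSet.π₀.mk_surjective f
    obtain ⟨g, rfl⟩ := SSet.π₀.mk_surjective g
    obtain ⟨h, rfl⟩ := SSet.π₀.mk_surjective h
    exact congrArg SSet.π₀.mk (A.compSimplex_assoc f g h)

lemma onHom_idVertex {A B : SCat.{u}} (F : A ⟶ B) (x : A) :
    (onHom F x x).app (op ⦋0⦌) (A.idVertex x) = B.idVertex (onObj F x) :=
  ConcreteCategory.congr_hom (congr_app (EnrichedFunctor.map_id F x) (op ⦋0⦌)) PUnit.unit

lemma onHom_compSimplex {A B : SCat.{u}} (F : A ⟶ B) {x y z : A} {n : SimplexCategoryᵒᵖ}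
    (f : (A.hom x y).obj n) (g : (A.hom y z).obj n) :
    (onHom F x z).app n (A.compSimplex f g) =
      B.compSimplex ((onHom F x y).app n f) ((onHom F y z).app n g) :=
  ConcreteCategory.congr_hom (congr_app (EnrichedFunctor.map_comp F x y z) n)
    (simplexPair (X := A.hom x y) (Y := A.hom y z) f g)

/-- The functor induced by a simplicial functor on the categories of components. -/
def componentsMap {A B : SCat.{u}} (F : A ⟶ B) : A.Components ⥤ B.Components where
  obj x := ⟨onObj F x.as⟩
  map {x y} f := SSet.mapπ₀ (onHom F x.as y.as) f
  map_id x := congrArg SSet.π₀.mk (onHom_idVertex F x.as)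
  map_comp f g := by
    obtain ⟨f, rfl⟩ := SSet.π₀.mk_surjective f
    obtain ⟨g, rfl⟩ := SSet.π₀.mk_surjective g
    exact congrArg SSet.π₀.mk (onHom_compSimplex F f g)

/-! ### The model structure on simplicial categories -/

/-- A functor `F : C ⥤ D` is an isofibration if every isomorphism `v : y' ≅ F x` of `D` is the
image of some isomorphism `u : x' ≅ x` of `C` (so that, in particular, `F x' = y'`). -/
def IsIsofibration {C D : Type*} [Category* C] [Category* D] (F : C ⥤ D) : Prop :=
  ∀ (x : C) (y' : D) (v : y' ≅ F.obj x),
    ∃ (x' : C) (u : x' ≅ x) (h : F.obj x' = y'), F.map u.hom = eqToHom h ≫ v.hom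

/-- A simplicial functor is locally in a class `K` of maps of simplicial sets if all the maps
`A(x, y) ⟶ B(F x, F y)` are in `K`. -/
def locally (K : MorphismProperty SSet.{u}) : MorphismProperty SCat.{u} :=
  fun A _ F => ∀ x y : A, K (onHom F x y)

/-- The weak equivalences of simplicial categories are the Dwyer-Kan equivalences: the functors
that are locally weak equivalences and essentially surjective on categories of components. -/
instance : CategoryWithWeakEquivalences SCat.{u} where
  weakEquivalences := fun _ _ F =>
    locally (weakEquivalences SSet.{u}) F ∧ (componentsMap F).EssSurj

/-- The fibrations of simplicial categories are the Dwyer-Kan fibrations: the functors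
that are locally Kan fibrations and induce an isofibration on categories of components. -/
instance : CategoryWithFibrations SCat.{u} where
  fibrations := fun _ _ F =>
    locally (fibrations SSet.{u}) F ∧ IsIsofibration (componentsMap F)

/-- The cofibrations of simplicial categories are the maps with the left lifting property with
respect to the trivial fibrations. -/
instance : CategoryWithCofibrations SCat.{u} where
  cofibrations := (trivialFibrations SCat.{u}).llp

end SCat

/-! ### The model structure on simplicial monoids -/

namespace SMon

/-- A map of simplicial monoids is a weak equivalence if it is one of simplicial sets. -/
instance : CategoryWithWeakEquivalences (Mon SSet.{u}) where
  weakEquivalences := (weakEquivalences SSet.{u}).inverseImage (Mon.forget SSet.{u})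

/-- A map of simplicial monoids is a fibration if it is one of simplicial sets. -/
instance : CategoryWithFibrations (Mon SSet.{u}) where
  fibrations := (fibrations SSet.{u}).inverseImage (Mon.forget SSet.{u})

/-- The cofibrations of simplicial monoids are the maps with the left lifting property with
respect to the trivial fibrations. -/
instance : CategoryWithCofibrations (Mon SSet.{u}) where
  cofibrations := (trivialFibrations (Mon SSet.{u})).llp

end SMon

/-- The endomorphism simplicial monoid `A(a, a)` of an object of a simplicial category: its unit
and multiplication are the identity and the composition of `A`. -/
def SCat.endMon (A : SCat.{u}) (a : A) : Mon SSet.{u} where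
  X := A.hom a a
  mon :=
    { one := eId SSet.{u} a
      mul := eComp SSet.{u} a a a
      one_mul := (Iso.inv_comp_eq _).mp (e_id_comp SSet.{u} a a) |>.trans (Category.comp_id _)
      mul_one := (Iso.inv_comp_eq _).mp (e_comp_id SSet.{u} a a) |>.trans (Category.comp_id _)
      mul_assoc := (e_assoc' SSet.{u} a a a a).symm }

/-!
It suffices that every map `π : N ⟶ A(a, a)` of simplicial monoids whose underlying map is a trivial
fibration has a section. Through `π`, each `A(a, x)` is a module over `N`. Choose cofibrant modules
`P x` with trivial fibrations `P x ⟶ A(a, x)`, where `P a` is `N` itself and its map to `A(a, a)` is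
`π`. Let `B` be the simplicial category with the objects of `A` whose morphisms from `x` to `y` are
the morphisms `b` of `A` from `x` to `y` together with a map of modules `P x ⟶ P y` lying over the
composition `A(a, x) ⟶ A(a, y)` with `b`. Then `B(x, y) ⟶ A(x, y)` is a base change of
`Map(P x, P y) ⟶ Map(P x, A(a, y))`, which is a trivial fibration because `P x` is cofibrant. So
`B ⟶ A` is a trivial fibration and, `A` being cofibrant, it has a section. A section of `π` is the
composite `A(a, a) ⟶ B(a, a) ⟶ Map(N, N) ≅ N`.
-/

open Limits SSet SSet.modelCategoryQuillen

/-! ### Trivial fibrations of simplicial sets -/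

section TrivialFibrations

lemma I_rlp_le_fibrations : I.{u}.rlp ≤ fibrations SSet.{u} := by
  rw [← rlp_monomorphisms, fibrations_eq]
  exact MorphismProperty.antitone_rlp J_le_monomorphisms

lemma I_rlp_le_weakEquivalences : I.{u}.rlp ≤ weakEquivalences SSet.{u} := by
  intro X Y p hp
  refine ⟨X, 𝟙 X, p, ?_, hp, Category.id_comp _⟩
  rw [anodyneExtensions_eq_llp_rlp]
  exact MorphismProperty.llp_of_isIso _ _

lemma trivialFibrations_eq_I_rlp : trivialFibrations SSet.{u} = I.rlp := by
  ext X Y p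
  refine ⟨?_, fun hp => ⟨I_rlp_le_fibrations p hp, I_rlp_le_weakEquivalences p hp⟩⟩
  rintro ⟨hp, Z, i, q, hi, hq, rfl⟩
  rw [anodyneExtensions_eq_llp_rlp] at hi
  have : HasLiftingProperty i (i ≫ q) := hi _ hp
  exact MorphismProperty.of_retract (RetractArrow.ofRightLiftingProperty rfl) hq

/-- The map from a discrete simplicial set which is given by a family of vertices. -/
def ofVertices {T : Type u} {X : SSet.{u}} (v : T → X _⦋0⦌) :
    (Functor.const SimplexCategoryᵒᵖ).obj T ⟶ X where
  app n := ↾fun t => X.map (SimplexCategory.const n.unop ⦋0⦌ 0).op (v t)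
  naturality m n α := by
    ext t
    change _ = X.map α (X.map _ (v t))
    rw [← Functor.map_comp_apply]
    rfl

lemma ofVertices_app_zero {T : Type u} {X : SSet.{u}} (v : T → X _⦋0⦌) (t : T) :
    (ofVertices v).app (op ⦋0⦌) t = v t := by
  change X.map _ (v t) = v t
  rw [SimplexCategory.const_eq_id, op_id, Functor.map_id_apply]

lemma ofVertices_comp {T : Type u} {X Y : SSet.{u}} (v : T → X _⦋0⦌) (p : X ⟶ Y) :
    ofVertices v ≫ p = ofVertices (fun t => p.app _ (v t)) := by
  ext n t
  exact NatTrans.naturality_apply p _ _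

lemma mono_ofVertices {T : Type u} {X : SSet.{u}} {v : T → X _⦋0⦌} (hv : Function.Injective v) :
    Mono (ofVertices v) := by
  have (n : SimplexCategoryᵒᵖ) : Mono ((ofVertices v).app n) := by
    refine (mono_iff_injective _).2 fun s t h => hv ?_
    have h₀ := congrArg (X.map (SimplexCategory.const ⦋0⦌ n.unop 0).op) h
    rw [← NatTrans.naturality_apply, ← NatTrans.naturality_apply] at h₀
    exact (ofVertices_app_zero v s).symm.trans (h₀.trans (ofVertices_app_zero v t))
  exact NatTrans.mono_of_mono_app _

variable {X Y : SSet.{u}} {p : X ⟶ Y} (hp : I.rlp p)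

include hp

lemma hasLiftingProperty_of_I_rlp {A B : SSet.{u}} (i : A ⟶ B) [Mono i] :
    HasLiftingProperty i p := by
  rw [← rlp_monomorphisms] at hp
  exact hp i (.infer_property i)

lemma app_zero_surjective_of_I_rlp : Function.Surjective (p.app (op ⦋0⦌)) := fun y => by
  have := hasLiftingProperty_of_I_rlp hp (initial.to Y)
  have sq : CommSq (initial.to X) (initial.to Y) p (𝟙 Y) := ⟨initialIsInitial.hom_ext _ _⟩
  exact ⟨sq.lift.app _ y, congr($(sq.fac_right).app (op ⦋0⦌) y)⟩

lemma nonempty_edge_of_I_rlp {x₀ x₁ : X _⦋0⦌} (e : Y.Edge (p.app _ x₀) (p.app _ x₁)) :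
    Nonempty (X.Edge x₀ x₁) := by
  let s : Δ[1] _⦋1⦌ := stdSimplex.objEquiv.symm (𝟙 _)
  let endpoint (t : ULift.{u} Bool) : Δ[1] _⦋0⦌ := bif t.down then Δ[1].δ 0 s else Δ[1].δ 1 s
  have : Mono (ofVertices endpoint) := by
    have hne : Δ[1].δ 1 s ≠ Δ[1].δ 0 s := fun h =>
      absurd congr((stdSimplex.objEquiv $h).toOrderHom 0) (by decide)
    refine mono_ofVertices fun ⟨t⟩ ⟨t'⟩ h => ?_
    cases t <;> cases t'
    exacts [rfl, absurd h hne, absurd h.symm hne, rfl]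
  have := hasLiftingProperty_of_I_rlp hp (ofVertices endpoint)
  obtain ⟨f, hf⟩ : ∃ f : Δ[1] ⟶ Y, f.app _ s = e.edge := ⟨_, yonedaEquiv_symm_app_id _⟩
  have sq : CommSq (ofVertices fun t => bif t.down then x₁ else x₀) (ofVertices endpoint) p f := ⟨by
    rw [ofVertices_comp, ofVertices_comp]
    congr 1
    funext ⟨t⟩
    cases t
    · exact e.src_eq.symm.trans (hf ▸ ((Edge.mk' s).map f).src_eq)
    · exact e.tgt_eq.symm.trans (hf ▸ ((Edge.mk' s).map f).tgt_eq)⟩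
  have h (t) : sq.lift.app _ (endpoint t) = bif t.down then x₁ else x₀ := by
    simpa only [ofVertices_comp, ofVertices_app_zero] using
      congr($(sq.fac_left).app (op ⦋0⦌) t)
  exact ⟨((Edge.mk' s).map sq.lift).ofEq (h ⟨false⟩) (h ⟨true⟩)⟩

lemma mapπ₀_bijective_of_I_rlp : Function.Bijective (mapπ₀ p) := by
  obtain ⟨r, hr⟩ := (app_zero_surjective_of_I_rlp hp).hasRightInverse
  have edge {x₀ x₁ : X _⦋0⦌} (e : Y.Edge (p.app _ x₀) (p.app _ x₁)) : π₀.mk x₀ = π₀.mk x₁ :=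
    π₀.sound (nonempty_edge_of_I_rlp hp e).some
  refine Function.bijective_iff_has_inverse.2 ⟨π₀.lift (fun y => π₀.mk (r y))
    fun y₀ y₁ e => edge (e.ofEq (hr y₀).symm (hr y₁).symm), fun x => ?_, fun y => ?_⟩
  · induction x with | mk x
    exact edge ((Edge.id _).ofEq (hr _).symm rfl)
  · induction y with | mk y
    exact congrArg π₀.mk (hr y)

end TrivialFibrations

/-! ### Modules over simplicial monoids -/

/-- The category whose copresheaves are the copresheaves on `C` with a left action of the
copresheaf of monoids `M`. A morphism acts by functoriality along its base, followed by the
multiplication by its coefficient. -/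
structure ActionCat {C : Type*} [Category* C] (M : C ⥤ MonCat.{u}) where
  /-- The underlying object of `C`. -/
  as : C

namespace ActionCat

variable {C : Type*} [Category* C] {M : C ⥤ MonCat.{u}}

/-- The morphisms of `ActionCat M`. -/
@[ext]
structure Hom (x y : ActionCat M) where
  /-- The underlying morphism of `C`. -/
  base : x.as ⟶ y.as
  /-- The element by which to multiply after transport along `base`. -/
  coeff : M.obj y.as

@[simps]
instance : Category (ActionCat M) where
  Hom := Hom
  id x := ⟨𝟙 x.as, 1⟩
  comp f g := ⟨f.base ≫ g.base, g.coeff * M.map g.base f.coeff⟩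
  id_comp f := Hom.ext (Category.id_comp _) (by simp)
  comp_id f := Hom.ext (Category.comp_id _) (by simp)
  assoc f g h := Hom.ext (Category.assoc _ _ _) (by simp [mul_assoc])

variable (M)

/-- The projection to the base category: restriction along it endows a copresheaf with the trivial
action. -/
def forget : ActionCat M ⥤ C where
  obj x := x.as
  map f := f.base

/-- The inclusion of the base category: restriction along it forgets the action. -/
def incl : C ⥤ ActionCat M where
  obj x := ⟨x⟩
  map f := ⟨f, 1⟩
  map_id _ := rfl
  map_comp _ _ := Hom.ext rfl (by simp)

end ActionCat

open ActionCat

/-- The category of simplicial sets with a left action of a simplicial monoid. -/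
abbrev SModule (M : SimplexCategoryᵒᵖ ⥤ MonCat.{u}) := ActionCat M ⥤ Type u

namespace SModule

variable {M : SimplexCategoryᵒᵖ ⥤ MonCat.{u}}

variable (M) in
/-- The functor that forgets the action. -/
abbrev underlying : SModule M ⥤ SSet.{u} := (Functor.whiskeringLeft _ _ _).obj (incl M)

variable (M) in
/-- The functor that endows a simplicial set with the trivial action. -/
abbrev triv : SSet.{u} ⥤ SModule M := (Functor.whiskeringLeft _ _ _).obj (forget M)

section MappingSpaces

variable {P Q L : SModule M} {X : SSet.{u}}

lemma homObj_naturality_apply (φ : P.HomObj Q L) {k j : ActionCat M} (f : k ⟶ j) (l : L.obj k)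
    (x : P.obj k) : φ.app j (L.map f l) (P.map f x) = Q.map f (φ.app k l x) :=
  congr($(φ.naturality f l) x)

lemma homObj_ext {φ ψ : P.HomObj Q L} (h : ∀ k l x, φ.app k l x = ψ.app k l x) : φ = ψ := by
  ext k l x
  exact h k l x

/-- Families of maps from `P` to `Q` which are parametrized by the standard `n`-simplex. -/
abbrev Family (P Q : SModule M) (n : SimplexCategoryᵒᵖ) : Type u :=
  P.HomObj Q ((triv M).obj (stdSimplex.obj n.unop))

/-- The simplicial set of maps from `P` to a variable module: its `n`-simplices are the families
parametrized by the standard `n`-simplex. -/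
def mapSpace (P : SModule M) : SModule M ⥤ SSet.{u} where
  obj Q := (stdSimplex ⋙ triv M).op ⋙ P.homObjFunctor Q
  map q := { app n := ↾fun φ => φ.comp (.ofNatTrans q) }

/-- An `n`-simplex of the simplicial set of maps, as a family. -/
abbrev familyOfSimplex {n : SimplexCategoryᵒᵖ} (s : ((mapSpace P).obj Q).obj n) : Family P Q n := s

/-- The nondegenerate `n`-simplex of the standard `n`-simplex. -/
abbrev topSimplex (n : SimplexCategoryᵒᵖ) : (stdSimplex.{u}.obj n.unop).obj n :=
  stdSimplex.objEquiv.symm (𝟙 _)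

/-- The maps from `X` to the simplicial set of maps from `P` to `Q` are the families of maps
which are parametrized by `X`. -/
def familyEquiv : P.HomObj Q ((triv M).obj X) ≃ (X ⟶ (mapSpace P).obj Q) where
  toFun φ :=
    { app n := ↾fun s => φ.map ((triv M).map (yonedaEquiv.symm s))
      naturality n m α := by
        ext s
        exact congr(φ.map ((triv M).map $((yonedaEquiv_symm_naturality_left α.unop s).symm))) }
  invFun ψ :=
    { app k l := (familyOfSimplex (ψ.app k.as l)).app k (topSimplex k.as)
      naturality {k j} f l := by
        have h : familyOfSimplex (ψ.app j.as (X.map f.base l)) = _ :=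
          NatTrans.naturality_apply ψ f.base l
        exact congr(_ ≫ Functor.HomObj.app $h j (topSimplex j.as)).trans
          ((familyOfSimplex (ψ.app k.as l)).naturality f (topSimplex k.as)) }
  left_inv φ := by
    ext k l x
    exact congr(φ.app k $(Functor.map_id_apply X _ l) x)
  right_inv ψ := by
    ext n s
    refine homObj_ext fun k l x => ?_
    have h : familyOfSimplex (ψ.app _ (X.map (stdSimplex.objEquiv l).op s)) = _ :=
      NatTrans.naturality_apply ψ (stdSimplex.objEquiv l).op s
    exact congr(Functor.HomObj.app $h k (topSimplex _) x).trans
      congr((familyOfSimplex (ψ.app n s)).app k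
        $(stdSimplex.objEquiv.injective (Category.comp_id _)) x)

/-- The simplicial set of maps out of `P` is right adjoint to the product with `P`. -/
noncomputable def mapSpaceAdj (P : SModule M) : triv M ⋙ tensorRight P ⊣ mapSpace P :=
  (Adjunction.mkOfHomEquiv
    { homEquiv _ Q := (P.homObjEquiv Q _).symm.trans familyEquiv
      homEquiv_naturality_left_symm _ _ := rfl
      homEquiv_naturality_right _ _ := rfl }).ofNatIsoLeft
    (Functor.isoWhiskerLeft _ (BraidedCategory.tensorLeftIsoTensorRight P))

end MappingSpaces

section RegularModule

variable (M) in
/-- The regular module: the simplicial monoid acts on itself by left multiplication. -/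
def reg : SModule M where
  obj x := M.obj x.as
  map f := ↾fun m => f.coeff * M.map f.base m
  map_comp f g := by ext; simp [mul_assoc]

instance (x : ActionCat M) : Monoid ((reg M).obj x) := inferInstanceAs (Monoid (M.obj x.as))

lemma reg_map_one {k j : ActionCat M} (f : k ⟶ j) : (reg M).map f 1 = f.coeff :=
  (congrArg (f.coeff * ·) (map_one (M.map f.base).hom)).trans (mul_one _)

variable {Q : SModule M} {n : SimplexCategoryᵒᵖ}

/-- The value of a family of maps out of the regular module at the unit. -/
abbrev value (φ : Family (reg M) Q n) : Q.obj ⟨n⟩ := φ.app ⟨n⟩ (topSimplex n) 1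

lemma app_eq_map_value (φ : Family (reg M) Q n) {k : ActionCat M}
    (l : (stdSimplex.{u}.obj n.unop).obj k.as) (m : M.obj k.as) :
    φ.app k l m = Q.map (⟨(stdSimplex.objEquiv l).op, m⟩ : (⟨n⟩ : ActionCat M) ⟶ k) (value φ) := by
  let f : (⟨n⟩ : ActionCat M) ⟶ k := ⟨(stdSimplex.objEquiv l).op, m⟩
  have hl : (stdSimplex.{u}.obj n.unop).map f.base (topSimplex n) = l :=
    stdSimplex.objEquiv.injective (Category.comp_id (stdSimplex.objEquiv l))
  exact congr(φ.app k $(hl.symm) $((reg_map_one f).symm)).trans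
    (homObj_naturality_apply φ f (topSimplex n) 1)

lemma value_comp (φ ψ : Family (reg M) (reg M) n) : value (φ.comp ψ) = value φ * value ψ :=
  (app_eq_map_value ψ (topSimplex n) (value φ)).trans
    (congrArg (value φ * ·) (ConcreteCategory.congr_hom (M.map_id n) (value ψ)))

variable (M) in
/-- Maps out of the regular module are determined by the value at the unit. -/
def mapSpaceReg : mapSpace (reg M) ≅ underlying M :=
  NatIso.ofComponents (fun Q => NatIso.ofComponents (fun n => Equiv.toIso
    { toFun := value
      invFun x :=
        { app k l := ↾fun m =>
            Q.map (⟨(stdSimplex.objEquiv l).op, m⟩ : (⟨n⟩ : ActionCat M) ⟶ k) x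
          naturality {k _} f l := by
            ext m
            exact Functor.map_comp_apply Q
              (⟨(stdSimplex.objEquiv l).op, m⟩ : (⟨n⟩ : ActionCat M) ⟶ k) f x }
      left_inv φ := homObj_ext fun k l m => (app_eq_map_value φ l m).symm
      right_inv x := Functor.map_id_apply Q _ x }) fun α => by
    ext φ
    exact (app_eq_map_value (familyOfSimplex φ) _ _).trans
      congr(Q.map (⟨($(Category.id_comp α.unop)).op, (1 : M.obj _)⟩ : Hom _ _) (value φ)))
    fun _ => rfl

end RegularModule

section Cofibrant

/-- The maps of modules whose underlying map of simplicial sets is a trivial fibration. -/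
def trivFib : MorphismProperty (SModule M) := I.rlp.inverseImage (underlying M)

/-- A module is cofibrant if the map to it from the initial module has the left lifting property
with respect to the trivial fibrations. -/
def Cofibrant (P : SModule M) : Prop := trivFib.llp (initial.to P)

variable (M) in
/-- The free module on a simplicial set. -/
abbrev free : SSet.{u} ⥤ SModule M := triv M ⋙ tensorRight (reg M)

variable (M) in
/-- The adjunction between free modules and underlying simplicial sets. -/
noncomputable def freeAdj : free M ⊣ underlying M :=
  (mapSpaceAdj (reg M)).ofNatIsoRight (mapSpaceReg M)

variable (M) in
/-- The generating cofibrations of modules: the free maps on the boundary inclusions. -/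
def genCof : MorphismProperty (SModule M) := .ofHoms fun n : ℕ => (free M).map ∂Δ[n].ι

lemma rlp_genCof : (genCof M).rlp = trivFib := by
  ext Q R q
  refine ⟨fun h _ _ _ ⟨n⟩ => ?_, fun h _ _ _ ⟨n⟩ => ?_⟩
  · exact ((freeAdj M).hasLiftingProperty_iff _ _).1 (h _ ⟨n⟩)
  · exact ((freeAdj M).hasLiftingProperty_iff _ _).2 (h _ ⟨n⟩)

variable {X Y : SSet.{u}} {P Q R : SModule M} {q : Q ⟶ R}

lemma hasLiftingProperty_free_map (i : X ⟶ Y) [Mono i] (hq : trivFib q) :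
    HasLiftingProperty ((free M).map i) q :=
  ((freeAdj M).hasLiftingProperty_iff _ _).2 (hasLiftingProperty_of_I_rlp hq _)

lemma cofibrant_reg : Cofibrant (reg M) := fun Q R q hq => by
  have h : IsInitial ((free M).obj (⊥_ SSet.{u})) := initialIsInitial.isInitialObj (free M)
  let e : Arrow.mk ((free M).map (initial.to (𝟙_ SSet.{u}))) ≅ Arrow.mk (initial.to (reg M)) :=
    Arrow.isoMk (h.uniqueUpToIso initialIsInitial) (λ_ (reg M)) (h.hom_ext _ _)
  have := hasLiftingProperty_free_map (initial.to (𝟙_ SSet.{u})) hq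
  exact .of_arrow_iso_left e q

variable (M X Y) in
/-- The free module on a product is the product of a simplicial set and a free module. -/
def freeProdIso : (free M).obj (X ⊗ Y) ≅ (triv M).obj X ⊗ (free M).obj Y :=
  α_ ((triv M).obj X) ((triv M).obj Y) (reg M)

/-- The pushout-product of an inclusion of simplicial sets and a free map on an inclusion is the
free map on their pushout-product. -/
noncomputable def pushoutProductFree (S : X.Subcomplex) (T : Y.Subcomplex) :
    (curriedTensor (SModule M)).PushoutObjObj ((triv M).map S.ι) ((free M).map T.ι) where
  pt := (free M).obj (S.unionProd T)
  inl := (freeProdIso M _ _).inv ≫ (free M).map (Subcomplex.unionProd.ι₁ S T)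
  inr := (freeProdIso M _ _).inv ≫ (free M).map (Subcomplex.unionProd.ι₂ S T)
  isPushout :=
    ((Subcomplex.unionProd.isPushout S T).map (free M)).of_iso (freeProdIso M S T)
      (freeProdIso M X T) (freeProdIso M S Y) (Iso.refl _) rfl rfl rfl rfl
  ι := (free M).map (S.unionProd T).ι ≫ (freeProdIso M X Y).hom
  inl_ι := rfl
  inr_ι := rfl

lemma trivFib_pullbackHom (S : X.Subcomplex) (hq : trivFib q) :
    trivFib (Functor.PullbackObjObj.ofHasPullback MonoidalClosed.internalHom
      ((triv M).map S.ι) q).π := by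
  rw [← rlp_genCof]
  rintro _ _ _ ⟨n⟩
  rw [← MonoidalClosed.internalHomAdjunction₂.hasLiftingProperty_iff (pushoutProductFree S ∂Δ[n])]
  have := hasLiftingProperty_free_map (S.unionProd ∂Δ[n]).ι hq
  exact .of_comp_left ((free M).map (S.unionProd ∂Δ[n]).ι) (freeProdIso M _ Δ[n]).hom q

lemma I_rlp_mapSpace_map (hP : Cofibrant P) (hq : trivFib q) : I.rlp ((mapSpace P).map q) := by
  rintro _ _ _ ⟨n⟩
  rw [← (mapSpaceAdj P).hasLiftingProperty_iff]
  exact (MonoidalClosed.internalHomAdjunction₂.hasLiftingProperty_iff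
    (Functor.PushoutObjObj.ofIsInitialRight (curriedTensor _) ((triv M).map ∂Δ[n].ι)
      (initial.to P) initialIsInitial)
    (Functor.PullbackObjObj.ofHasPullback _ _ _)).2 (hP _ (trivFib_pullbackHom _ hq))

end Cofibrant

section SmallObjectArgument

attribute [local instance] Cardinal.fact_isRegular_aleph0 Cardinal.orderBotAleph0OrdToType

instance : MorphismProperty.IsSmall.{u} (genCof M) := MorphismProperty.isSmall_ofHoms ..

instance : MorphismProperty.HasSmallObjectArgument.{u} (genCof M) := by
  refine ⟨.aleph0, inferInstance, inferInstance, { preservesColimit := ?_ }⟩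
  rintro _ _ _ _ _ ⟨n⟩ _ _
  have : (underlying M).IsCardinalAccessible Cardinal.aleph0.{u} := ⟨fun _ _ _ => inferInstance⟩
  have : IsFinitelyPresentable.{u} ((free M).obj (∂Δ[n] : SSet.{u})) :=
    (freeAdj M).isCardinalPresentable_leftAdjoint_obj _ _
  infer_instance

lemma exists_cofibrant_replacement (Q : SModule M) :
    ∃ (P : SModule M) (p : P ⟶ Q), Cofibrant P ∧ trivFib p := by
  let F := MorphismProperty.factorizationData (genCof M).rlp.llp (genCof M).rlp (initial.to Q)
  refine ⟨F.Z, F.p, ?_, rlp_genCof.le _ F.hp⟩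
  rw [Cofibrant, ← rlp_genCof, ← initialIsInitial.hom_ext F.i (initial.to F.Z)]
  exact F.hi

end SmallObjectArgument

end SModule

open SModule

/-! ### Resolutions of a simplicial category -/

open CartesianMonoidalCategory

/-- The fiber product of two maps of simplicial sets. It is carved out of the product, so that its
simplices are pairs. -/
def fiberProduct {X Y Z : SSet.{u}} (f : X ⟶ Z) (g : Y ⟶ Z) : (X ⊗ Y).Subcomplex where
  obj n := {t | f.app n t.1 = g.app n t.2}
  map α t ht := (NatTrans.naturality_apply f α t.1).trans
    (congr(Z.map α $ht).trans (NatTrans.naturality_apply g α t.2).symm)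

lemma isPullback_fiberProduct {X Y Z : SSet.{u}} (f : X ⟶ Z) (g : Y ⟶ Z) :
    IsPullback ((fiberProduct f g).ι ≫ fst _ _) ((fiberProduct f g).ι ≫ snd _ _) f g :=
  ⟨⟨by ext n t; exact t.2⟩, ⟨PullbackCone.IsLimit.mk _
    (fun s => Subcomplex.lift (lift s.fst s.snd) (by
      rintro n _ ⟨t, rfl⟩
      exact congr($(s.condition).app n t)))
    (fun s => rfl) (fun s => rfl) (fun s m h₁ h₂ => by
      ext n t
      exact Subtype.ext (Prod.ext congr(($h₁).app n t) congr(($h₂).app n t)))⟩⟩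

namespace SMon

/-- The monoid of `n`-simplices of a simplicial monoid. -/
abbrev monoidObj (N : Mon SSet.{u}) (n : SimplexCategoryᵒᵖ) : Monoid (N.X.obj n) where
  mul s t := (MonObj.mul (X := N.X)).app n (SCat.simplexPair s t)
  one := (MonObj.one (X := N.X)).app n PUnit.unit
  one_mul s := congr($(MonObj.one_mul N.X).app n
    (SCat.simplexPair (X := 𝟙_ SSet.{u}) PUnit.unit s))
  mul_one s := congr($(MonObj.mul_one N.X).app n
    (SCat.simplexPair (Y := 𝟙_ SSet.{u}) s PUnit.unit))
  mul_assoc s t r := congr($(MonObj.mul_assoc N.X).app n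
    (SCat.simplexPair (X := N.X ⊗ N.X) (SCat.simplexPair s t) r))

/-- A simplicial monoid, as a presheaf of monoids. -/
def toPresheaf (N : Mon SSet.{u}) : SimplexCategoryᵒᵖ ⥤ MonCat.{u} where
  obj n := @MonCat.of (N.X.obj n) (monoidObj N n)
  map {n m} α := @MonCat.ofHom _ _ (monoidObj N n) (monoidObj N m)
    (letI := monoidObj N n; letI := monoidObj N m
    { toFun := N.X.map α
      map_one' := (NatTrans.naturality_apply (MonObj.one (X := N.X)) α PUnit.unit).symm
      map_mul' s t := (NatTrans.naturality_apply (MonObj.mul (X := N.X)) α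
        (SCat.simplexPair (X := N.X) (Y := N.X) s t)).symm })
  map_id n := MonCat.hom_ext (DFunLike.ext _ _ (Functor.map_id_apply N.X n))
  map_comp α β := MonCat.hom_ext (DFunLike.ext _ _ (Functor.map_comp_apply N.X α β))

end SMon

namespace SCat

section IdSimplex

variable (A : SCat.{u}) {x y : A} {m n : SimplexCategoryᵒᵖ}

/-- The identity of `x`, as an `n`-simplex of `A(x, x)`. -/
def idSimplex (x : A) (n : SimplexCategoryᵒᵖ) : (A.hom x x).obj n :=
  (eId SSet.{u} x).app n PUnit.unit

lemma map_idSimplex (x : A) (α : m ⟶ n) :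
    (A.hom x x).map α (A.idSimplex x m) = A.idSimplex x n :=
  (NatTrans.naturality_apply (eId SSet.{u} x) α PUnit.unit).symm

lemma idSimplex_comp (f : (A.hom x y).obj n) : A.compSimplex (A.idSimplex x n) f = f :=
  congr($(e_id_comp SSet.{u} x y).app n f)

lemma comp_idSimplex (f : (A.hom x y).obj n) : A.compSimplex f (A.idSimplex y n) = f :=
  congr($(e_comp_id SSet.{u} x y).app n f)

end IdSimplex

variable {A : SCat.{u}} {a : A} {N : Mon SSet.{u}}

section HomModules

variable (π : N ⟶ A.endMon a) {m n : SimplexCategoryᵒᵖ}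

lemma hom_app_mul (s t : (SMon.toPresheaf N).obj n) :
    π.hom.app n (s * t) = A.compSimplex (π.hom.app n s) (π.hom.app n t) :=
  congr($(IsMonHom.mul_hom π.hom).app n (SCat.simplexPair (X := N.X) (Y := N.X) s t))

lemma hom_app_one (n : SimplexCategoryᵒᵖ) :
    π.hom.app n (1 : (SMon.toPresheaf N).obj n) = A.idSimplex a n :=
  congr($(IsMonHom.one_hom π.hom).app n PUnit.unit)

lemma hom_app_map (α : m ⟶ n) (s : (SMon.toPresheaf N).obj m) :
    π.hom.app n ((SMon.toPresheaf N).map α s) = (A.hom a a).map α (π.hom.app m s) :=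
  NatTrans.naturality_apply π.hom α s

/-- The simplicial set `A(a, x)`, on which a simplicial monoid over `A(a, a)` acts by
precomposition. -/
def homModule (x : A) : SModule (SMon.toPresheaf N) where
  obj k := (A.hom a x).obj k.as
  map f := ↾fun s => A.compSimplex (π.hom.app _ f.coeff) ((A.hom a x).map f.base s)
  map_id k := by
    ext s
    exact congr(A.compSimplex $(hom_app_one π k.as)
      $(Functor.map_id_apply (A.hom a x) k.as s)).trans (A.idSimplex_comp s)
  map_comp f g := by
    ext s
    have h := (hom_app_mul π g.coeff ((SMon.toPresheaf N).map g.base f.coeff)).trans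
      (congrArg _ (hom_app_map π g.base f.coeff))
    exact congr(A.compSimplex $h $(Functor.map_comp_apply (A.hom a x) f.base g.base s)).trans
      ((A.compSimplex_assoc _ _ _).trans (congrArg _ (A.map_compSimplex _ _ _).symm))

/-- Forgetting the action on the module `A(a, x)`. -/
def underlyingHomModuleIso (x : A) : (underlying _).obj (homModule π x) ≅ A.hom a x :=
  NatIso.ofComponents (fun _ => Iso.refl _) fun {n m} α => by
    ext s
    exact congr(A.compSimplex $(hom_app_one π m) _).trans (A.idSimplex_comp _)

variable (N) in
/-- Forgetting the action on the regular module. -/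
def underlyingRegIso : (underlying _).obj (reg (SMon.toPresheaf N)) ≅ N.X :=
  NatIso.ofComponents (fun _ => Iso.refl _) fun {n m} α => by
    ext s
    exact one_mul ((SMon.toPresheaf N).map α s)

/-- A map of simplicial monoids to `A(a, a)`, as a map of modules. -/
def regHom : reg (SMon.toPresheaf N) ⟶ homModule π a where
  app k := ↾fun s => π.hom.app k.as s
  naturality k l f := by
    ext s
    exact (hom_app_mul π f.coeff _).trans (congrArg _ (hom_app_map π f.base s))

lemma trivFib_regHom (hπ : I.rlp π.hom) : trivFib (regHom π) :=
  (MorphismProperty.arrow_mk_iso_iff _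
    (Arrow.isoMk (underlyingRegIso N) (underlyingHomModuleIso π a) rfl)).2 hπ

/-- The map `A(a, x) ⟶ A(a, y)` of modules, as the morphism from `x` to `y` varies. -/
def postcomp (x y : A) : (homModule π x).HomObj (homModule π y) ((triv _).obj (A.hom x y)) where
  app k f := ↾fun s => A.compSimplex s f
  naturality g f := by
    ext s
    exact (A.compSimplex_assoc _ _ _).trans
      congr(A.compSimplex _ $((A.map_compSimplex _ _ _).symm))

/-- A cofibrant resolution of the module `A(a, x)`, where the object `x` is part of the data. -/
structure Resolution where
  /-- The object `x` of the resolved module `A(a, x)`. -/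
  pt : A
  /-- The resolving module. -/
  obj : SModule (SMon.toPresheaf N)
  /-- The augmentation. -/
  aug : obj ⟶ homModule π pt
  cofibrant : Cofibrant obj
  trivFib : trivFib aug

end HomModules

namespace Resolution

variable {π : N ⟶ A.endMon a}

section ResolvedHom

variable (r s t : Resolution π)

/-- The maps of modules from the first resolution which lie over the postcomposition with a
variable morphism of `A`. -/
def mapOver : A.hom r.pt s.pt ⟶ (mapSpace r.obj).obj (homModule π s.pt) :=
  familyEquiv ((Functor.HomObj.ofNatTrans r.aug).comp (postcomp π _ _))

/-- The simplicial set of morphisms of `A` with a lift of the postcomposition to resolutions. -/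
def resolvedHom : SSet.{u} := fiberProduct (mapOver r s) ((mapSpace r.obj).map s.aug)

/-- The map that forgets the lift to resolutions. -/
def resolvedProj : resolvedHom r s ⟶ A.hom r.pt s.pt := Subcomplex.ι _ ≫ fst _ _

lemma I_rlp_resolvedProj : I.rlp (resolvedProj r s) :=
  MorphismProperty.of_isPullback (isPullback_fiberProduct _ _).flip
    (I_rlp_mapSpace_map r.cofibrant s.trivFib)

/-- The augmentation on simplices. -/
abbrev augSimplex {k : ActionCat (SMon.toPresheaf N)} (x : r.obj.obj k) :
    (A.hom a r.pt).obj k.as := r.aug.app k x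

variable {r s t} {n : SimplexCategoryᵒᵖ}

/-- The underlying morphism of `A`. -/
abbrev base (f : (resolvedHom r s).obj n) : (A.hom r.pt s.pt).obj n := f.1.1

/-- The lift of the postcomposition to resolutions. -/
abbrev family (f : (resolvedHom r s).obj n) : Family r.obj s.obj n := f.1.2

lemma aug_family (f : (resolvedHom r s).obj n) {k : ActionCat (SMon.toPresheaf N)}
    (l : (stdSimplex.{u}.obj n.unop).obj k.as) (x : r.obj.obj k) :
    augSimplex s ((family f).app k l x) =
      A.compSimplex (augSimplex r x) ((A.hom _ _).map (stdSimplex.objEquiv l).op (base f)) :=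
  congr(Functor.HomObj.app $(f.2.symm) k l x)

/-- A morphism of `A` with a lift of the postcomposition, from its two components. -/
def mkResolved (b : (A.hom r.pt s.pt).obj n) (φ : Family r.obj s.obj n)
    (h : ∀ k l x, augSimplex s (φ.app k l x) =
      A.compSimplex (augSimplex r x) ((A.hom _ _).map (stdSimplex.objEquiv l).op b)) :
    (resolvedHom r s).obj n :=
  ⟨⟨b, φ⟩, homObj_ext fun k l x => (h k l x).symm⟩

variable (r n) in
/-- The identity, lifted to resolutions by the identity. -/
def resolvedId : (resolvedHom r r).obj n :=
  mkResolved (A.idSimplex _ n) (.ofNatTrans (𝟙 _)) fun _ _ _ =>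
    ((congrArg _ (A.map_idSimplex _ _)).trans (A.comp_idSimplex _)).symm

/-- The composition of morphisms of `A` and of their lifts to resolutions. -/
def resolvedComp (f : (resolvedHom r s).obj n) (g : (resolvedHom s t).obj n) :
    (resolvedHom r t).obj n :=
  mkResolved (A.compSimplex (base f) (base g)) ((family f).comp (family g)) fun k l x => by
    let fₗ := (A.hom _ _).map (stdSimplex.objEquiv l).op (base f)
    let gₗ := (A.hom _ _).map (stdSimplex.objEquiv l).op (base g)
    calc augSimplex t ((family g).app k l ((family f).app k l x))
      _ = A.compSimplex (augSimplex s ((family f).app k l x)) gₗ := aug_family g l _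
      _ = A.compSimplex (A.compSimplex (augSimplex r x) fₗ) gₗ :=
        congr(A.compSimplex $(aug_family f l x) gₗ)
      _ = A.compSimplex (augSimplex r x) (A.compSimplex fₗ gₗ) := A.compSimplex_assoc _ _ _
      _ = A.compSimplex (augSimplex r x) ((A.hom _ _).map _ (A.compSimplex (base f) (base g))) :=
        congrArg _ (A.map_compSimplex _ _ _).symm

end ResolvedHom

variable {ι : Type u} (ρ : ι → Resolution π)

/-- The simplicial category of a family of resolutions: its morphisms are the morphisms of `A` with
a lift of the postcomposition to resolutions. -/
def resolved : SCat.{u} where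
  Obj := ι
  enriched :=
    { Hom i j := resolvedHom (ρ i) (ρ j)
      id i :=
        { app n := ↾fun _ => resolvedId (ρ i) n
          naturality n m α := by
            ext
            exact Subtype.ext (Prod.ext (A.map_idSimplex _ α).symm rfl) }
      comp i j k :=
        { app n := ↾fun t => resolvedComp t.1 t.2
          naturality n m α := by
            ext t
            exact Subtype.ext (Prod.ext (A.map_compSimplex α _ _).symm rfl) }
      id_comp i j := by
        ext n t
        exact Subtype.ext (Prod.ext (A.idSimplex_comp _) rfl)
      comp_id i j := by
        ext n t
        exact Subtype.ext (Prod.ext (A.comp_idSimplex _) rfl)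
      assoc i j k l := by
        ext n t
        exact Subtype.ext (Prod.ext (A.compSimplex_assoc _ _ _) rfl) }

/-- The simplicial functor that forgets the lifts to resolutions. -/
def resolvedFunctor : resolved ρ ⟶ A where
  obj i := (ρ i).pt
  map i j := resolvedProj (ρ i) (ρ j)
  map_id _ := rfl
  map_comp _ _ _ := rfl

end Resolution

/-! ### Sections of trivial fibrations of simplicial categories -/

section Functors

lemma isIsofibration_of_surjective_obj {C D : Type*} [Category* C] [Category* D] (F : C ⥤ D)
    [F.Full] [F.Faithful] (h : Function.Surjective F.obj) : IsIsofibration F := by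
  intro x y' v
  obtain ⟨x', rfl⟩ := h y'
  exact ⟨x', F.preimageIso v, rfl, by simp⟩

variable {A B : SCat.{u}}

lemma trivialFibrations_of_locally {F : A ⟶ B} (hF : locally I.rlp F)
    (h : Function.Surjective (onObj F)) : trivialFibrations SCat.{u} F := by
  have : (componentsMap F).Full := ⟨fun {x y} => (mapπ₀_bijective_of_I_rlp (hF x.as y.as)).2⟩
  have : (componentsMap F).Faithful := ⟨fun {x y} => @(mapπ₀_bijective_of_I_rlp (hF x.as y.as)).1⟩
  have h' : Function.Surjective (componentsMap F).obj := fun ⟨y⟩ => by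
    obtain ⟨x, rfl⟩ := h y
    exact ⟨⟨x⟩, rfl⟩
  refine ⟨⟨fun x y => I_rlp_le_fibrations _ (hF x y), isIsofibration_of_surjective_obj _ h'⟩,
    fun x y => I_rlp_le_weakEquivalences _ (hF x y), ⟨fun y => ?_⟩⟩
  obtain ⟨x, rfl⟩ := h' y
  exact ⟨x, ⟨Iso.refl _⟩⟩

/-- The action of a simplicial functor on endomorphism monoids. -/
def endMap (F : A ⟶ B) (x : A) : A.endMon x ⟶ B.endMon (onObj F x) where
  hom := onHom F x x
  isMonHom_hom :=
    { one_hom := EnrichedFunctor.map_id F x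
      mul_hom := EnrichedFunctor.map_comp F x x x }

lemma endMap_comp_eqToHom {F : A ⟶ A} (hF : F = 𝟙 A) (x : A)
    (h : A.endMon (onObj F x) = A.endMon x) : endMap F x ≫ eqToHom h = 𝟙 _ := by
  subst hF
  rfl

lemma eqToHom_comp_endMap (F : A ⟶ B) {x y : A} (h : x = y) :
    eqToHom (congrArg A.endMon h) ≫ endMap F y =
      endMap F x ≫ eqToHom (congrArg (fun z => B.endMon (onObj F z)) h) := by
  subst h
  exact (Category.id_comp _).trans (Category.comp_id _).symm

lemma exists_section_endMap {G : A ⟶ B} {F : B ⟶ A} (h : G ≫ F = 𝟙 A)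
    (hF : Function.Injective (onObj F)) (b : B) :
    ∃ g : A.endMon (onObj F b) ⟶ B.endMon b, g ≫ endMap F b = 𝟙 _ := by
  have hb : onObj G (onObj F b) = b := hF congr(onObj $h (onObj F b))
  refine ⟨endMap G _ ≫ eqToHom (congrArg B.endMon hb), ?_⟩
  rw [Category.assoc, eqToHom_comp_endMap F hb]
  exact endMap_comp_eqToHom h _ _

end Functors

variable {π : N ⟶ A.endMon a}

namespace Resolution

lemma trivialFibrations_resolvedFunctor {ι : Type u} (ρ : ι → Resolution π)
    (h : Function.Surjective fun i => (ρ i).pt) :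
    trivialFibrations SCat.{u} (resolvedFunctor ρ) :=
  trivialFibrations_of_locally (fun i j => I_rlp_resolvedProj (ρ i) (ρ j)) h

variable (π) in
/-- An arbitrary resolution of `A(a, x)`. -/
noncomputable def ofCofibrant (x : A) : Resolution π where
  pt := x
  obj := (exists_cofibrant_replacement (homModule π x)).choose
  aug := (exists_cofibrant_replacement (homModule π x)).choose_spec.choose
  cofibrant := (exists_cofibrant_replacement (homModule π x)).choose_spec.choose_spec.1
  trivFib := (exists_cofibrant_replacement (homModule π x)).choose_spec.choose_spec.2

variable (hπ : I.rlp π.hom)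

/-- The resolution of `A(a, a)` by the regular module. -/
def ofRegular : Resolution π where
  pt := a
  obj := reg _
  aug := regHom π
  cofibrant := cofibrant_reg
  trivFib := trivFib_regHom π hπ

/-- A resolution for each object of `A`, which is the regular module for `a`. With `none` as index
of `a`, the latter holds by definition. -/
noncomputable def resolutions : Option {x : A // x ≠ a} → Resolution π :=
  fun i => i.elim (ofRegular hπ) (ofCofibrant π ·)

lemma bijective_pt_resolutions : Function.Bijective fun i => (resolutions hπ i).pt := by
  classical
  convert (Equiv.optionSubtypeNe a).bijective with i
  cases i <;> rfl

/-- The evaluation at the unit of the lifts to the regular module. -/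
noncomputable def evalHom : (resolved (resolutions hπ)).endMon none ⟶ N where
  hom := Subcomplex.ι _ ≫ snd _ _ ≫ (mapSpaceReg _).hom.app (reg _) ≫ (underlyingRegIso N).hom
  isMonHom_hom :=
    { one_hom := rfl
      mul_hom := by
        ext n t
        exact value_comp (family t.1) (family t.2) }

lemma evalHom_comp : evalHom hπ ≫ π = endMap (resolvedFunctor (resolutions hπ)) none := by
  ext n t
  have h := aug_family (r := ofRegular hπ) (s := ofRegular hπ) t (topSimplex n)
    (1 : (reg (SMon.toPresheaf N)).obj ⟨n⟩)
  exact h.trans (congr(A.compSimplex $(hom_app_one π n)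
    $(Functor.map_id_apply (A.hom a a) n (base t))).trans (A.idSimplex_comp _))

end Resolution

lemma exists_section_of_isCofibrant (hA : IsCofibrant A) (hπ : I.rlp π.hom) :
    ∃ σ : A.endMon a ⟶ N, σ ≫ π = 𝟙 _ := by
  let F := Resolution.resolvedFunctor (Resolution.resolutions hπ)
  have hpt := Resolution.bijective_pt_resolutions hπ
  have sq : CommSq (initial.to _) (initial.to A) F (𝟙 A) := ⟨initialIsInitial.hom_ext _ _⟩
  have := hA.mem _ (Resolution.trivialFibrations_resolvedFunctor _ hpt.surjective)
  obtain ⟨s, hs⟩ := exists_section_endMap sq.fac_right hpt.injective none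
  exact ⟨s ≫ Resolution.evalHom hπ, (Category.assoc _ _ _).trans
    (congr(s ≫ $(Resolution.evalHom_comp hπ)).trans hs)⟩

end SCat

theorem lemma2p4 (A : SCat.{u}) (hA : IsCofibrant A) (a : A) : IsCofibrant (A.endMon a) := by
  refine ⟨fun Q R q hq => ⟨fun {f g} sq => ?_⟩⟩
  have hq' : I.rlp ((Mon.forget SSet.{u}).map q) := trivialFibrations_eq_I_rlp.le _ hq
  have hπ : I.rlp (pullback.snd q g).hom :=
    MorphismProperty.of_isPullback ((IsPullback.of_hasPullback q g).map (Mon.forget SSet.{u})) hq'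
  obtain ⟨σ, hσ⟩ := SCat.exists_section_of_isCofibrant hA hπ
  refine ⟨⟨⟨σ ≫ pullback.fst q g, initialIsInitial.hom_ext _ _, ?_⟩⟩⟩
  rw [Category.assoc, pullback.condition, reassoc_of% hσ]
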